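/- Let $p_1,\dots,p_n$ be distinct primes, let $U_1,\dots,U_m$ be pairwise non-isomorphic finite nonabelian simple groups ($n,m\ge 0$), let $f_1,\dots,f_n,e_1,\dots,e_m$ be nonnegative integers, and let $C_p$ denote the cyclic group of order $p$. For a finite group $G$, let $\mu(G)$ be its Möbius number, i.e. the value $\mu(\{1\},G)$ of the Möbius function of the lattice of all subgroups of $G$ (the inverse of the zeta function in the incidence algebra of this lattice). If $$G\cong C_{p_1}^{f_1}\times\cdots\times C_{p_n}^{f_n}\times U_1^{e_1}\times\cdots\times U_m^{e_m},$$ then $$\mu(G)=(-1)^{F}\,\prod_{i=1}^{n}p_i^{\binom{f_i}{2}}\,\prod_{i=1}^{m}\prod_{j=1}^{e_i}\bigl(\mu(U_i)-(j-1)\,|\mathrm{Aut}(U_i)|\bigr),\qquad F=\sum_{i=1}^{n}f_i .$$ Moreover, the socle of every finite group (the subgroup generated by all of its minimal normal subgroups) is isomorphic to a group $G$ of this form. -/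

import Mathlib

universe u v w

/-- The Möbius number `μ(G)` of a finite group `G`: the value `μ(⊥, ⊤)` of the Möbius function of
the lattice of subgroups of `G`. -/
noncomputable def mobiusNumber (G : Type u) [Group G] [Finite G] : ℤ :=
  letI : DecidableEq (Subgroup G) := Classical.decEq _
  letI : DecidableLE (Subgroup G) := Classical.decRel _
  letI : DecidableLT (Subgroup G) := Classical.decRel _
  letI : Fintype (Subgroup G) := Fintype.ofFinite _
  letI : LocallyFiniteOrder (Subgroup G) := Fintype.toLocallyFiniteOrder
  IncidenceAlgebra.mu ℤ (⊥ : Subgroup G) (⊤ : Subgroup G)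

/-- `N` is a minimal normal subgroup: minimal among the nontrivial normal subgroups. -/
def IsMinimalNormal {G : Type u} [Group G] (N : Subgroup G) : Prop :=
  Minimal (fun H : Subgroup G => H.Normal ∧ H ≠ ⊥) N

/-- The socle of a group: the subgroup generated by all minimal normal subgroups. -/
def socle (G : Type u) [Group G] : Subgroup G :=
  sSup {N : Subgroup G | IsMinimalNormal N}

/-- The hypotheses on the simple factors: the `p i` are distinct primes and the `U i` are pairwise
non-isomorphic nonabelian simple groups (their finiteness is a separate instance argument). -/
structure AdmissibleFactors {n m : ℕ} (p : Fin n → ℕ) (U : Fin m → Type u)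
    [∀ i, Group (U i)] : Prop where
  prime : ∀ i, (p i).Prime
  distinct : Function.Injective p
  simple : ∀ i, IsSimpleGroup (U i)
  nonabelian : ∀ i, ∃ a b : U i, a * b ≠ b * a
  nonisomorphic : ∀ i j, i ≠ j → IsEmpty (U i ≃* U j)

/-- The direct product `C_{p_1}^{f_1} × ⋯ × C_{p_n}^{f_n} × U_1^{e_1} × ⋯ × U_m^{e_m}`, where
`C_p` is the cyclic group of order `p`. -/
abbrev SimpleProduct {n m : ℕ} (p f : Fin n → ℕ) (U : Fin m → Type u) (e : Fin m → ℕ) : Type u :=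
  ((i : Fin n) → Fin (f i) → Multiplicative (ZMod (p i))) × ((i : Fin m) → Fin (e i) → U i)

/-! Peel one simple factor `N` off a product `H × N`. The normal subgroup `1 × N` satisfies the
modular law in the subgroup lattice, so Crapo's formula writes `μ(H × N)` as a sum over its
complements, which are the graphs of homomorphisms `φ : H → N`. Each graph is isomorphic to `H`,
hence `μ(H × N) = μ(H) · ∑ μ(graph φ, ⊤)`. If `N` is abelian or `φ` is onto, simplicity of `N` makes
the graph maximal and its term is `-1`; the graph of the trivial map contributes `μ(N)`.

Choose `N` of least order among the factors. A homomorphism from a factor to `N` is then trivial or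
an isomorphism. With `k` of the other factors isomorphic to `N`, there are `p ^ k` homomorphisms
when `|N| = p` is prime, and `k · |Aut N|` nontrivial ones, all onto, when `N` is nonabelian. So `N`
contributes `-p ^ k` or `μ(N) - k · |Aut N|`, and induction on the number of factors gives the
formula.

For the socle: a group generated by its minimal normal subgroups is the direct product of some of
them, and these are simple. The socle is such a group; it remains to collect isomorphic factors. -/

/-! ### Möbius functions of finite posets; Weisner's and Crapo's theorems -/

section PosetMoebius

/-- The Möbius function of a finite partial order, with classical instances. -/
noncomputable def posetMoebius {α : Type*} [PartialOrder α] [Finite α] (a b : α) : ℤ :=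
  letI : DecidableEq α := Classical.decEq _
  letI : DecidableLE α := Classical.decRel _
  letI : DecidableLT α := Classical.decRel _
  letI : Fintype α := Fintype.ofFinite _
  letI : LocallyFiniteOrder α := Fintype.toLocallyFiniteOrder
  IncidenceAlgebra.mu ℤ a b

theorem mobiusNumber_eq_posetMoebius (G : Type*) [Group G] [Finite G] :
    mobiusNumber G = posetMoebius (⊥ : Subgroup G) ⊤ := rfl

open Classical in
theorem sum_posetMoebius_right {α : Type*} [PartialOrder α] [Fintype α] (a b : α) :
    ∑ x with a ≤ x ∧ x ≤ b, posetMoebius a x = if a = b then 1 else 0 := by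
  let _ : DecidableEq α := Classical.decEq _
  let _ : DecidableLE α := Classical.decRel _
  let _ : DecidableLT α := Classical.decRel _
  let _ : Fintype α := Fintype.ofFinite _
  let _ : LocallyFiniteOrder α := Fintype.toLocallyFiniteOrder
  have h := IncidenceAlgebra.sum_Icc_mu_right (𝕜 := ℤ) a b
  rw [← h]
  refine Finset.sum_congr ?_ fun _ _ ↦ rfl
  ext x
  simp

open Classical in
theorem sum_posetMoebius_left {α : Type*} [PartialOrder α] [Fintype α] (a b : α) :
    ∑ x with a ≤ x ∧ x ≤ b, posetMoebius x b = if a = b then 1 else 0 := by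
  let _ : DecidableEq α := Classical.decEq _
  let _ : DecidableLE α := Classical.decRel _
  let _ : DecidableLT α := Classical.decRel _
  let _ : Fintype α := Fintype.ofFinite _
  let _ : LocallyFiniteOrder α := Fintype.toLocallyFiniteOrder
  have h := IncidenceAlgebra.sum_Icc_mu_left (𝕜 := ℤ) a b
  rw [← h]
  refine Finset.sum_congr ?_ fun _ _ ↦ rfl
  ext x
  simp

theorem posetMoebius_self {α : Type*} [PartialOrder α] [Finite α] (a : α) :
    posetMoebius a a = 1 := by
  simp [posetMoebius]

/-- An order embedding whose range contains the interval `[f a, f b]` preserves the Möbius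
function on `[a, b]`. -/
theorem posetMoebius_map {α β : Type*} [PartialOrder α] [Finite α] [PartialOrder β] [Finite β]
    (f : β ↪o α) (a b : β) (h : ∀ z, f a ≤ z → z ≤ f b → z ∈ Set.range f) :
    posetMoebius (f a) (f b) = posetMoebius a b := by
  classical
  have := Fintype.ofFinite α
  have := Fintype.ofFinite β
  induction b using WellFoundedLT.induction with
  | ind b ih =>
    have hα := sum_posetMoebius_right (f a) (f b)
    have hβ := sum_posetMoebius_right a b
    have himg : (Finset.univ.filter fun x ↦ f a ≤ x ∧ x ≤ f b) =
        (Finset.univ.filter fun x ↦ a ≤ x ∧ x ≤ b).map f.toEmbedding := by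
      ext z
      simp only [Finset.mem_filter, Finset.mem_univ, true_and, Finset.mem_map]
      constructor
      · rintro ⟨h1, h2⟩
        obtain ⟨y, rfl⟩ := h z h1 h2
        exact ⟨y, by simpa using And.intro h1 h2, rfl⟩
      · rintro ⟨y, hy, rfl⟩
        simpa using hy
    rw [himg, Finset.sum_map] at hα
    by_cases hab : a ≤ b
    · have hb : b ∈ Finset.univ.filter fun x ↦ a ≤ x ∧ x ≤ b := by simp [hab]
      rw [← Finset.add_sum_erase _ _ hb] at hα hβ
      have hrest : ∑ x ∈ (Finset.univ.filter fun x ↦ a ≤ x ∧ x ≤ b).erase b,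
          posetMoebius (f a) (f x) =
          ∑ x ∈ (Finset.univ.filter fun x ↦ a ≤ x ∧ x ≤ b).erase b, posetMoebius a x := by
        refine Finset.sum_congr rfl fun x hx ↦ ?_
        simp only [Finset.mem_erase, Finset.mem_filter, Finset.mem_univ, true_and] at hx
        exact ih x (lt_of_le_of_ne hx.2.2 hx.1) fun z h1 h2 ↦
          h z h1 (h2.trans (f.monotone hx.2.2))
      simp only [RelEmbedding.coe_toEmbedding, EmbeddingLike.apply_eq_iff_eq] at hα
      linarith
    · have h1 : ¬ f a ≤ f b := by simpa using hab
      simp only [posetMoebius]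
      rw [IncidenceAlgebra.apply_eq_zero_of_not_le hab, IncidenceAlgebra.apply_eq_zero_of_not_le h1]

theorem posetMoebius_orderIso {α β : Type*} [PartialOrder α] [Finite α] [PartialOrder β] [Finite β]
    (f : β ≃o α) (a b : β) : posetMoebius (f a) (f b) = posetMoebius a b :=
  posetMoebius_map f.toOrderEmbedding a b fun z _ _ ↦ f.surjective z

theorem posetMoebius_of_covBy {α : Type*} [PartialOrder α] [Finite α] {a b : α} (h : a ⋖ b) :
    posetMoebius a b = -1 := by
  classical
  have := Fintype.ofFinite α
  have hs := sum_posetMoebius_right a b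
  have : (Finset.univ.filter fun x ↦ a ≤ x ∧ x ≤ b) = {a, b} := by
    ext x
    simp only [Finset.mem_filter, Finset.mem_univ, true_and, Finset.mem_insert,
      Finset.mem_singleton]
    constructor
    · rintro ⟨h1, h2⟩
      exact h.eq_or_eq h1 h2
    · rintro (rfl | rfl)
      · exact ⟨le_rfl, h.le⟩
      · exact ⟨h.le, le_rfl⟩
  rw [this, Finset.sum_pair h.ne, posetMoebius_self, if_neg h.ne] at hs
  linarith

open Classical in
/-- Weisner's theorem. -/
theorem sum_posetMoebius_sup_eq {α : Type*} [Lattice α] [OrderBot α] [Fintype α] {a : α}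
    (ha : a ≠ ⊥) (y : α) (hy : a ≤ y) :
    ∑ x with x ⊔ a = y, posetMoebius ⊥ x = 0 := by
  induction y using WellFoundedLT.induction with
  | ind y ih =>
    have h0 := sum_posetMoebius_right ⊥ y
    rw [if_neg (by rintro rfl; exact ha (le_bot_iff.mp hy))] at h0
    -- Split the vanishing sum over `[⊥, y]` by the value of `x ⊔ a`; every fibre over `z < y`
    -- vanishes by induction.
    have hfib := Finset.sum_fiberwise_of_maps_to
      (s := Finset.univ.filter fun x : α ↦ ⊥ ≤ x ∧ x ≤ y)
      (t := Finset.univ.filter fun z : α ↦ a ≤ z ∧ z ≤ y) (g := fun x ↦ x ⊔ a)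
      (fun x hx ↦ by simp at hx ⊢; exact ⟨hx, hy⟩) (fun x ↦ posetMoebius ⊥ x)
    rw [h0] at hfib
    have hz : ∀ z ∈ Finset.univ.filter (fun z : α ↦ a ≤ z ∧ z ≤ y),
        ∑ x ∈ (Finset.univ.filter fun x : α ↦ ⊥ ≤ x ∧ x ≤ y) with x ⊔ a = z, posetMoebius ⊥ x =
        ∑ x with x ⊔ a = z, posetMoebius ⊥ x := by
      intro z hz
      simp only [Finset.mem_filter, Finset.mem_univ, true_and] at hz
      refine Finset.sum_congr ?_ fun _ _ ↦ rfl
      ext x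
      simp only [Finset.mem_filter, Finset.mem_univ, true_and, bot_le]
      exact ⟨fun h ↦ h.2, fun h ↦ ⟨le_sup_left.trans (h.trans_le hz.2), h⟩⟩
    rw [Finset.sum_congr rfl hz, Finset.sum_eq_single y] at hfib
    · exact hfib
    · intro z hz hzy
      simp only [Finset.mem_filter, Finset.mem_univ, true_and] at hz
      exact ih z (lt_of_le_of_ne hz.2 hzy) hz.1
    · intro h
      simp [hy] at h

open Classical in
/-- Crapo's complementation formula for an element satisfying the modular law. -/
theorem posetMoebius_eq_sum_isCompl {α : Type*} [Lattice α] [BoundedOrder α] [Fintype α] (a : α)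
    (hmod : ∀ x y, x ≤ y → (x ⊔ a) ⊓ y ≤ x ⊔ (a ⊓ y)) :
    posetMoebius (⊥ : α) ⊤ =
      ∑ y with IsCompl a y, posetMoebius ⊥ y * posetMoebius y ⊤ := by
  -- When `y ⊔ a = ⊤`, the modular law turns `x ⊔ a = ⊤` into `x ⊔ (a ⊓ y) = y`, so Weisner's
  -- theorem kills the sum unless `a ⊓ y = ⊥`.
  have key : ∀ y, ∑ x with x ≤ y ∧ x ⊔ a = ⊤, posetMoebius ⊥ x =
      if IsCompl a y then posetMoebius ⊥ y else 0 := by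
    intro y
    by_cases hy : y ⊔ a = ⊤
    · have hset : (Finset.univ.filter fun x : α ↦ x ≤ y ∧ x ⊔ a = ⊤) =
          Finset.univ.filter fun x ↦ x ⊔ (a ⊓ y) = y := by
        ext x
        simp only [Finset.mem_filter, Finset.mem_univ, true_and]
        constructor
        · rintro ⟨h1, h2⟩
          refine le_antisymm (sup_le h1 inf_le_right) ?_
          have := hmod x y h1
          rwa [h2, top_inf_eq] at this
        · intro h
          refine ⟨le_sup_left.trans h.le, ?_⟩
          rw [← hy]
          refine le_antisymm ?_ ?_
          · rw [hy]; exact le_top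
          · refine sup_le ?_ le_sup_right
            rw [← h]
            exact sup_le le_sup_left (inf_le_left.trans (le_sup_right))
      rw [hset]
      by_cases hb : a ⊓ y = ⊥
      · rw [if_pos ⟨disjoint_iff.mpr hb, codisjoint_iff.mpr (by rw [sup_comm, hy])⟩, hb]
        simp only [sup_bot_eq]
        rw [Finset.sum_filter, Finset.sum_ite_eq' Finset.univ y, if_pos (Finset.mem_univ _)]
      · rw [if_neg fun h ↦ hb h.inf_eq_bot]
        exact sum_posetMoebius_sup_eq hb y inf_le_right
    · rw [if_neg fun h ↦ hy (by rw [sup_comm, h.sup_eq_top])]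
      refine Finset.sum_eq_zero fun x hx ↦ ?_
      simp only [Finset.mem_filter, Finset.mem_univ, true_and] at hx
      exact absurd (top_le_iff.mp (hx.2.ge.trans (sup_le_sup_right hx.1 a))) hy
  have h1 : ∑ y with IsCompl a y, posetMoebius ⊥ y * posetMoebius y ⊤ =
      ∑ y, ∑ x, if x ≤ y ∧ x ⊔ a = ⊤ then posetMoebius ⊥ x * posetMoebius y ⊤ else 0 := by
    rw [Finset.sum_filter]
    refine Finset.sum_congr rfl fun y _ ↦ ?_
    have := congrArg (· * posetMoebius y ⊤) (key y)
    simp only [Finset.sum_filter, Finset.sum_mul, ite_mul, zero_mul] at this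
    exact this.symm
  -- After the swap, the inner sum of `μ(y, ⊤)` over `y ≥ x` is zero unless `x = ⊤`.
  rw [h1, Finset.sum_comm, Finset.sum_eq_single ⊤]
  · rw [Finset.sum_eq_single ⊤]
    · simp [posetMoebius_self]
    · intro y _ hy
      rw [if_neg fun h ↦ hy (top_le_iff.mp h.1)]
    · simp
  · intro x _ hx
    by_cases hxa : x ⊔ a = ⊤
    · have := sum_posetMoebius_left x ⊤
      rw [if_neg hx, Finset.sum_filter] at this
      have h2 := congrArg (posetMoebius ⊥ x * ·) this
      simpa [hxa, Finset.mul_sum] using h2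
    · simp [hxa]
  · simp

end PosetMoebius

/-! ### Subgroup lattices of direct products and graphs -/

section SubgroupMoebius

theorem mobiusNumber_congr {G : Type*} {H : Type*} [Group G] [Finite G] [Group H] [Finite H]
    (e : G ≃* H) : mobiusNumber G = mobiusNumber H := by
  rw [mobiusNumber_eq_posetMoebius, mobiusNumber_eq_posetMoebius,
    ← posetMoebius_orderIso e.mapSubgroup, map_bot, map_top]

theorem posetMoebius_bot_subgroup {G : Type*} [Group G] [Finite G] (K : Subgroup G) :
    posetMoebius ⊥ K = mobiusNumber K := by
  let f : Subgroup K ↪o Subgroup G :=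
    OrderEmbedding.ofMapLEIff (Subgroup.map K.subtype) fun _ _ ↦
      Subgroup.map_le_map_iff_of_injective K.subtype_injective
  have hbot : f ⊥ = ⊥ := Subgroup.map_bot _
  have htop : f ⊤ = K := by simp [f, ← MonoidHom.range_eq_map]
  rw [mobiusNumber_eq_posetMoebius, ← posetMoebius_map f, hbot, htop]
  exact fun z _ hz ↦ ⟨z.subgroupOf K, by simpa [f] using hz.trans htop.le⟩

/-- Dedekind's law: normality lets every element of `x ⊔ a` be written as a product `uv` with `u ∈
x`, `v ∈ a`. -/
theorem Subgroup.sup_inf_le_of_normal {G : Type*} [Group G] (a : Subgroup G) [a.Normal]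
    (x y : Subgroup G) (hxy : x ≤ y) : (x ⊔ a) ⊓ y ≤ x ⊔ (a ⊓ y) := by
  rintro g ⟨hg, hgy⟩
  obtain ⟨u, hu, v, hv, rfl⟩ := Subgroup.mem_sup_of_normal_right.mp hg
  have hvy : v ∈ y := (y.mul_mem_cancel_left (hxy hu)).mp hgy
  exact Subgroup.mul_mem_sup hu ⟨hv, hvy⟩

variable {H N : Type*} [Group H] [Group N]

theorem MonoidHom.graph_injective :
    Function.Injective (MonoidHom.graph : (H →* N) → Subgroup (H × N)) := by
  intro φ ψ h
  ext x
  have hx : (x, φ x) ∈ ψ.graph := h ▸ MonoidHom.mem_graph.mpr rfl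
  exact (MonoidHom.mem_graph.mp hx).symm

/-- Disjointness from `1 × N` makes the projection of `y` to `H` injective, and generating the whole
group with `1 × N` makes it surjective: `y` passes the vertical line test. -/
theorem isCompl_prod_iff_exists_graph (y : Subgroup (H × N)) :
    IsCompl ((⊥ : Subgroup H).prod (⊤ : Subgroup N)) y ↔ ∃ φ : H →* N, φ.graph = y := by
  constructor
  · intro h
    have hdis : ∀ n : N, (1, n) ∈ y → n = 1 := fun n hn ↦ by
      have := Subgroup.disjoint_def.mp h.disjoint (x := (1, n))
        (Subgroup.mem_prod.mpr ⟨Subgroup.one_mem _, Subgroup.mem_top _⟩) hn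
      exact congrArg Prod.snd this
    obtain ⟨φ, hφ⟩ := Subgroup.exists_eq_graph (G := y) ⟨by
      rintro ⟨⟨h₁, n₁⟩, hy₁⟩ ⟨⟨h₂, n₂⟩, hy₂⟩ heq
      have heq' : h₁ = h₂ := heq
      subst heq'
      have := y.mul_mem hy₁ (y.inv_mem hy₂)
      have := hdis (n₁ * n₂⁻¹) (by simpa using this)
      simpa [mul_inv_eq_one] using this, by
      intro x
      have hx : (x, (1 : N)) ∈ (⊥ : Subgroup H).prod (⊤ : Subgroup N) ⊔ y := by
        rw [h.sup_eq_top]; exact Subgroup.mem_top _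
      obtain ⟨u, hu, v, hv, huv⟩ := Subgroup.mem_sup_of_normal_left.mp hx
      refine ⟨⟨v, hv⟩, ?_⟩
      have hu1 : u.1 = 1 := (Subgroup.mem_prod.mp hu).1
      have := congrArg Prod.fst huv
      simpa [hu1] using this⟩
    exact ⟨φ, hφ.symm⟩
  · rintro ⟨φ, rfl⟩
    constructor
    · rw [Subgroup.disjoint_def]
      rintro ⟨x, n⟩ hx hn
      have hx1 : x = 1 := (Subgroup.mem_prod.mp hx).1
      have := MonoidHom.mem_graph.mp hn
      subst hx1
      simp at this
      simp [← this]
    · rw [codisjoint_iff, eq_top_iff]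
      rintro ⟨x, n⟩ -
      have : (x, n) = (1, n * (φ x)⁻¹) * (x, φ x) := by simp
      rw [this]
      exact Subgroup.mul_mem_sup
        (Subgroup.mem_prod.mpr ⟨Subgroup.one_mem _, Subgroup.mem_top _⟩)
        (MonoidHom.mem_graph.mpr rfl)

theorem mobiusNumber_graph [Finite H] [Finite N] (φ : H →* N) :
    mobiusNumber φ.graph = mobiusNumber H := by
  have hinj : Function.Injective ((MonoidHom.id H).prod φ) := fun x y h ↦ congrArg Prod.fst h
  exact (mobiusNumber_congr ((MonoidHom.ofInjective hinj).trans
    (MulEquiv.subgroupCongr φ.graph_eq_range_prod.symm))).symm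

theorem mobiusNumber_prod_eq_sum_graph [Finite H] [Finite N] [Fintype (H →* N)] :
    mobiusNumber (H × N) =
      mobiusNumber H * ∑ φ : H →* N, posetMoebius φ.graph ⊤ := by
  classical
  have := Fintype.ofFinite (Subgroup (H × N))
  rw [mobiusNumber_eq_posetMoebius, posetMoebius_eq_sum_isCompl
    ((⊥ : Subgroup H).prod (⊤ : Subgroup N)) (Subgroup.sup_inf_le_of_normal _)]
  have hset : (Finset.univ.filter fun y ↦ IsCompl ((⊥ : Subgroup H).prod (⊤ : Subgroup N)) y) =
      Finset.univ.map ⟨MonoidHom.graph, MonoidHom.graph_injective⟩ := by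
    ext y
    simp [isCompl_prod_iff_exists_graph]
  rw [hset, Finset.sum_map, Finset.mul_sum]
  refine Finset.sum_congr rfl fun φ _ ↦ ?_
  simp only [Function.Embedding.coeFn_mk]
  rw [posetMoebius_bot_subgroup, mobiusNumber_graph]

/-- A subgroup `L` above the graph is determined by its trace on `1 × N`. That trace is normal in
`N`, by conjugating with elements `(x, φ x)` of `L` or trivially when `N` is abelian, so it is `⊥`
or `⊤`. -/
theorem graph_covBy_top [IsSimpleGroup N] (φ : H →* N)
    (h : Function.Surjective φ ∨ ∀ a b : N, a * b = b * a) : φ.graph ⋖ ⊤ := by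
  refine ⟨lt_top_iff_ne_top.mpr fun htop ↦ ?_, fun L hL hLt ↦ ?_⟩
  · obtain ⟨n, hn⟩ := exists_ne (1 : N)
    have : ((1 : H), n) ∈ φ.graph := htop ▸ Subgroup.mem_top _
    have := MonoidHom.mem_graph.mp this
    simp at this
    exact hn this.symm
  · have hmem : ∀ x, (x, φ x) ∈ L := fun x ↦ hL.le (MonoidHom.mem_graph.mpr rfl)
    have hnorm : (L.comap (MonoidHom.inr H N)).Normal := by
      refine ⟨fun m hm g ↦ ?_⟩
      rcases h with h | h
      · obtain ⟨x, rfl⟩ := h g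
        have := L.mul_mem (L.mul_mem (hmem x) hm) (L.inv_mem (hmem x))
        simpa using this
      · rwa [h g m, mul_inv_cancel_right]
    have hdecomp : ∀ (x : H) (n : N), (x, n) = (1, n * (φ x)⁻¹) * (x, φ x) := by simp
    rcases hnorm.eq_bot_or_eq_top with hb | ht
    · refine hL.not_ge fun g hg ↦ ?_
      obtain ⟨x, n⟩ := g
      have h1 : n * (φ x)⁻¹ ∈ L.comap (MonoidHom.inr H N) := by
        rw [hdecomp, L.mul_mem_cancel_right (hmem x)] at hg
        exact hg
      rw [hb, Subgroup.mem_bot, mul_inv_eq_one] at h1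
      exact MonoidHom.mem_graph.mpr h1.symm
    · refine hLt.not_ge fun g _ ↦ ?_
      obtain ⟨x, n⟩ := g
      rw [hdecomp]
      have h1 : n * (φ x)⁻¹ ∈ L.comap (MonoidHom.inr H N) := ht ▸ Subgroup.mem_top _
      exact L.mul_mem h1 (hmem x)

/-- The graph of the trivial map is `H × 1`, and the subgroups above it are the `H × M` with `M ≤
N`. -/
theorem posetMoebius_graph_one [Finite H] [Finite N] :
    posetMoebius (1 : H →* N).graph ⊤ = mobiusNumber N := by
  let f : Subgroup N ↪o Subgroup (H × N) :=
    OrderEmbedding.ofMapLEIff (fun M ↦ (⊤ : Subgroup H).prod M) fun A B ↦ by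
      constructor
      · intro h n hn
        exact (Subgroup.mem_prod.mp
          (h (Subgroup.mem_prod.mpr ⟨Subgroup.mem_top 1, hn⟩ : ((1 : H), n) ∈ _))).2
      · exact fun h ↦ Subgroup.prod_mono le_rfl h
  have hbot : f ⊥ = (1 : H →* N).graph := by
    ext ⟨x, n⟩
    rw [MonoidHom.mem_graph]
    simp [f, Subgroup.mem_prod, eq_comm]
  have htop : f ⊤ = ⊤ := by simp [f]
  rw [mobiusNumber_eq_posetMoebius, ← posetMoebius_map f, hbot, htop]
  intro z hz _
  have hx : ∀ x : H, (x, (1 : N)) ∈ z := fun x ↦ hz (by rw [hbot, MonoidHom.mem_graph]; simp)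
  refine ⟨z.comap (MonoidHom.inr H N), ?_⟩
  ext ⟨x, n⟩
  have : (x, n) = (x, 1) * (1, n) := by simp
  rw [this, z.mul_mem_cancel_left (hx x)]
  simp [f, Subgroup.mem_prod]

end SubgroupMoebius

/-! ### Counting homomorphisms to a simple factor of least order -/

section HomCount

theorem MonoidHom.eq_one_or_bijective_of_card_le {A N : Type*} [Group A] [Group N]
    [IsSimpleGroup A] [Finite A] [Finite N] (hc : Nat.card N ≤ Nat.card A) (φ : A →* N) :
    φ = 1 ∨ Function.Bijective φ := by
  rcases (inferInstance : φ.ker.Normal).eq_bot_or_eq_top with h | h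
  · right
    rw [Nat.bijective_iff_injective_and_card]
    have hinj := (MonoidHom.ker_eq_bot_iff φ).mp h
    exact ⟨hinj, le_antisymm (Nat.card_le_card_of_injective φ hinj) hc⟩
  · exact Or.inl (MonoidHom.ker_eq_top_iff.mp h)

theorem Nat.card_mulEquiv_eq_ite (A N : Type*) [Group A] [Group N]
    [Decidable (Nonempty (A ≃* N))] :
    Nat.card (A ≃* N) = if Nonempty (A ≃* N) then Nat.card (MulAut N) else 0 := by
  split_ifs with h
  · obtain ⟨e⟩ := h
    exact Nat.card_congr
      ⟨fun f ↦ e.symm.trans f, fun f ↦ e.trans f, fun f ↦ by ext; simp, fun f ↦ by ext; simp⟩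
  · have := not_nonempty_iff.mp h
    simp

/-- Homomorphisms are the trivial one and the isomorphisms; in the isomorphic case `1 + |Aut N| = 1
+ (p - 1) = p`. -/
theorem Nat.card_monoidHom_eq_ite_of_prime {A N : Type*} [Group A] [Group N] [IsSimpleGroup A]
    [Finite A] [Finite N] (hc : Nat.card N ≤ Nat.card A) (hp : (Nat.card N).Prime)
    [Decidable (Nonempty (A ≃* N))] :
    Nat.card (A →* N) = if Nonempty (A ≃* N) then Nat.card N else 1 := by
  classical
  have : Nontrivial N := Finite.one_lt_card_iff_nontrivial.mp hp.one_lt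
  let g : Option (A ≃* N) → (A →* N) := fun o ↦ o.elim 1 MulEquiv.toMonoidHom
  have hg : Function.Bijective g := by
    constructor
    · have key : ∀ e : A ≃* N, e.toMonoidHom ≠ 1 := by
        intro e he
        obtain ⟨n, hn⟩ := exists_ne (1 : N)
        apply hn
        have := DFunLike.congr_fun he (e.symm n)
        simpa using this
      rintro (_ | e) (_ | e') h
      · rfl
      · exact absurd h.symm (key e')
      · exact absurd h (key e)
      · congr 1
        ext x
        exact DFunLike.congr_fun h x
    · intro φ
      rcases φ.eq_one_or_bijective_of_card_le hc with h | h
      · exact ⟨none, h.symm⟩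
      · exact ⟨some (MulEquiv.ofBijective φ h), rfl⟩
  rw [← Nat.card_congr (Equiv.ofBijective g hg), Finite.card_option, Nat.card_mulEquiv_eq_ite]
  have : IsCyclic N := by
    have := Fact.mk hp
    exact isCyclic_of_prime_card rfl
  split_ifs with h
  · rw [IsCyclic.card_mulAut, Nat.totient_prime hp, Nat.sub_add_cancel hp.one_lt.le]
  · rfl

variable {ι : Type*} [Fintype ι] {A : ι → Type*} [∀ i, Group (A i)] {N : Type*} [Group N]

theorem MonoidHom.ext_of_comp_mulSingle [DecidableEq ι] {φ ψ : (∀ i, A i) →* N}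
    (h : ∀ i x, φ (Pi.mulSingle i x) = ψ (Pi.mulSingle i x)) : φ = ψ := by
  apply MonoidHom.noncommPiCoprodEquiv.symm.injective
  refine Subtype.ext (funext fun i ↦ ?_)
  ext x
  exact h i x

/-- A nontrivial homomorphism from a product of simple groups to a nonabelian group whose order is at
most that of each factor is the projection to one factor followed by an isomorphism. -/
theorem MonoidHom.exists_eq_comp_evalMonoidHom [∀ i, Finite (A i)] [Finite N]
    [∀ i, IsSimpleGroup (A i)] (hc : ∀ i, Nat.card N ≤ Nat.card (A i))
    (hN : ∃ a b : N, a * b ≠ b * a) (φ : (∀ i, A i) →* N) (hφ : φ ≠ 1) :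
    ∃ i, ∃ e : A i ≃* N, φ = e.toMonoidHom.comp (Pi.evalMonoidHom A i) := by
  classical
  have hex : ∃ i, φ.comp (MonoidHom.mulSingle A i) ≠ 1 := by
    by_contra! h
    refine hφ (MonoidHom.ext_of_comp_mulSingle fun i x ↦ ?_)
    exact DFunLike.congr_fun (h i) x
  obtain ⟨i, hi⟩ := hex
  have hbij := ((φ.comp (MonoidHom.mulSingle A i)).eq_one_or_bijective_of_card_le
    (hc i)).resolve_left hi
  refine ⟨i, MulEquiv.ofBijective _ hbij, MonoidHom.ext_of_comp_mulSingle fun j x ↦ ?_⟩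
  rcases eq_or_ne j i with rfl | hj
  · simp
  have hcomm : ∀ (u : A j) (v : A i),
      Commute (φ (Pi.mulSingle j u)) (φ (Pi.mulSingle i v)) := fun u v ↦
    (Pi.mulSingle_commute hj u v).map φ
  rcases (φ.comp (MonoidHom.mulSingle A j)).eq_one_or_bijective_of_card_le (hc j) with h | h
  · have := DFunLike.congr_fun h x
    simp only [MonoidHom.comp_apply, MonoidHom.mulSingle_apply, MonoidHom.one_apply] at this
    simp [this, Pi.mulSingle_eq_of_ne hj.symm]
  -- Two distinct factors cannot both map onto `N`: their images commute elementwise.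
  · obtain ⟨a, b, hab⟩ := hN
    obtain ⟨u, rfl⟩ := h.2 a
    obtain ⟨v, rfl⟩ := hbij.2 b
    exact absurd (hcomm u v) hab

theorem mobiusNumber_pi_prod_of_comm [∀ i, Finite (A i)] [Finite N] [∀ i, IsSimpleGroup (A i)]
    [IsSimpleGroup N] (hc : ∀ i, Nat.card N ≤ Nat.card (A i)) (hN : ∀ a b : N, a * b = b * a)
    (hp : (Nat.card N).Prime) :
    mobiusNumber ((∀ i, A i) × N) = mobiusNumber (∀ i, A i) *
      -((Nat.card N : ℤ) ^ Nat.card {i // Nonempty (A i ≃* N)}) := by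
  classical
  have : Finite ((∀ i, A i) →* N) := DFunLike.finite _
  have := Fintype.ofFinite ((∀ i, A i) →* N)
  rw [mobiusNumber_prod_eq_sum_graph]
  congr 1
  rw [Finset.sum_congr rfl fun φ _ ↦ posetMoebius_of_covBy (graph_covBy_top φ (Or.inr hN))]
  have hpw : ∀ ϕ : ∀ i, A i →* N,
      Pairwise fun i j ↦ ∀ (x : A i) (y : A j), Commute (ϕ i x) (ϕ j y) :=
    fun _ _ _ _ _ _ ↦ hN _ _
  have hcard : Nat.card ((∀ i, A i) →* N) = Nat.card N ^ Nat.card {i // Nonempty (A i ≃* N)} := by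
    rw [← Nat.card_congr (MonoidHom.noncommPiCoprodEquiv (N := A) (M := N)),
      Nat.card_congr (Equiv.subtypeUnivEquiv hpw), Nat.card_pi,
      Finset.prod_congr rfl fun i _ ↦ Nat.card_monoidHom_eq_ite_of_prime (hc i) hp,
      Finset.prod_ite]
    simp [Fintype.card_subtype]
  rw [Finset.sum_const, Finset.card_univ, ← Nat.card_eq_fintype_card, hcard]
  simp

theorem mobiusNumber_pi_prod_of_noncomm [∀ i, Finite (A i)] [Finite N]
    [∀ i, IsSimpleGroup (A i)] [IsSimpleGroup N] (hc : ∀ i, Nat.card N ≤ Nat.card (A i))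
    (hN : ∃ a b : N, a * b ≠ b * a) :
    mobiusNumber ((∀ i, A i) × N) = mobiusNumber (∀ i, A i) *
      (mobiusNumber N -
        (Nat.card {i // Nonempty (A i ≃* N)} : ℤ) * (Nat.card (MulAut N) : ℤ)) := by
  classical
  have : Finite ((∀ i, A i) →* N) := DFunLike.finite _
  have := Fintype.ofFinite ((∀ i, A i) →* N)
  have : ∀ i, Finite (A i ≃* N) := fun i ↦ DFunLike.finite _
  rw [mobiusNumber_prod_eq_sum_graph]
  congr 1
  rw [← Finset.add_sum_erase _ _ (Finset.mem_univ 1), posetMoebius_graph_one]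
  let g : (Σ i, (A i ≃* N)) → {φ : (∀ i, A i) →* N // φ ≠ 1} := fun x ↦
    ⟨x.2.toMonoidHom.comp (Pi.evalMonoidHom A x.1), fun h ↦ by
      obtain ⟨n, hn⟩ := exists_ne (1 : N)
      apply hn
      have := DFunLike.congr_fun h (Pi.mulSingle x.1 (x.2.symm n))
      simpa using this⟩
  have hg : Function.Bijective g := by
    constructor
    · rintro ⟨i, e⟩ ⟨j, e'⟩ h
      have h' := congrArg Subtype.val h
      simp only [g] at h'
      have hij : i = j := by
        by_contra hij
        obtain ⟨n, hn⟩ := exists_ne (1 : N)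
        apply hn
        have := DFunLike.congr_fun h' (Pi.mulSingle i (e.symm n))
        simpa [Pi.mulSingle_eq_of_ne (Ne.symm hij)] using this
      subst hij
      congr 1
      ext x
      have := DFunLike.congr_fun h' (Pi.mulSingle i x)
      simpa using this
    · rintro ⟨φ, hφ⟩
      obtain ⟨i, e, h⟩ := φ.exists_eq_comp_evalMonoidHom hc hN hφ
      exact ⟨⟨i, e⟩, Subtype.ext h.symm⟩
  have hcard : (Finset.univ.erase (1 : (∀ i, A i) →* N)).card =
      Nat.card {i // Nonempty (A i ≃* N)} * Nat.card (MulAut N) := by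
    have h1 : (Finset.univ.erase (1 : (∀ i, A i) →* N)).card =
        Nat.card {φ : (∀ i, A i) →* N // φ ≠ 1} := by
      rw [Nat.card_eq_fintype_card, Fintype.card_subtype]
      congr 1
      ext
      simp
    rw [h1, ← Nat.card_congr (Equiv.ofBijective g hg), Nat.card_sigma,
      Finset.sum_congr rfl fun i _ ↦ Nat.card_mulEquiv_eq_ite (A i) N, ← Finset.sum_filter]
    simp [Fintype.card_subtype]
  rw [Finset.sum_congr rfl (g := fun _ ↦ (-1 : ℤ)) fun φ hφ ↦ posetMoebius_of_covBy
    (graph_covBy_top φ (Or.inl ?_)), Finset.sum_const, hcard]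
  · simp [sub_eq_add_neg]
  · obtain ⟨i, e, rfl⟩ := φ.exists_eq_comp_evalMonoidHom hc hN (Finset.ne_of_mem_erase hφ)
    intro n
    exact ⟨Pi.mulSingle i (e.symm n), by simp⟩

end HomCount

/-! ### The product formula -/

section SimpleProductMoebius

open Classical in
/-- The factor by which the Möbius number is multiplied when a simple group `N` is appended to a
product of simple groups of at least the same order, `k` of which are isomorphic to `N`. -/
noncomputable def simpleFactor (N : Type*) [Group N] [Finite N] (k : ℕ) : ℤ :=
  if ∀ a b : N, a * b = b * a then -((Nat.card N : ℤ) ^ k)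
  else mobiusNumber N - (k : ℤ) * (Nat.card (MulAut N) : ℤ)

theorem IsSimpleGroup.prime_card_of_comm {N : Type*} [Group N] [IsSimpleGroup N] [Finite N]
    (hN : ∀ a b : N, a * b = b * a) : (Nat.card N).Prime :=
  letI : CommGroup N := { ‹Group N› with mul_comm := hN }
  CommGroup.is_simple_iff_prime_card.mp ‹_›

theorem mobiusNumber_pi_prod {ι : Type*} [Finite ι] {A : ι → Type*} [∀ i, Group (A i)]
    {N : Type*} [Group N] [∀ i, Finite (A i)] [Finite N] [∀ i, IsSimpleGroup (A i)]
    [IsSimpleGroup N] (hc : ∀ i, Nat.card N ≤ Nat.card (A i)) :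
    mobiusNumber ((∀ i, A i) × N) = mobiusNumber (∀ i, A i) *
      simpleFactor N (Nat.card {i // Nonempty (A i ≃* N)}) := by
  have := Fintype.ofFinite ι
  rw [simpleFactor]
  split_ifs with h
  · exact mobiusNumber_pi_prod_of_comm hc h (IsSimpleGroup.prime_card_of_comm h)
  · push Not at h
    exact mobiusNumber_pi_prod_of_noncomm hc h

theorem mobiusNumber_of_subsingleton (G : Type*) [Group G] [Subsingleton G] :
    mobiusNumber G = 1 := by
  rw [mobiusNumber_eq_posetMoebius, Subsingleton.elim (⊤ : Subgroup G) ⊥, posetMoebius_self]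

theorem Nat.card_fiber_eq_card_fiber_ne_add {ι T : Type*} [Finite ι] [DecidableEq T] (τ : ι → T)
    (i₀ : ι) (t : T) :
    Nat.card {i // τ i = t} =
      Nat.card {j : {j // j ≠ i₀} // τ j = t} + if τ i₀ = t then 1 else 0 := by
  classical
  have := Fintype.ofFinite ι
  rw [Nat.card_congr (Equiv.subtypeSubtypeEquivSubtypeInter (fun j ↦ j ≠ i₀) (fun j ↦ τ j = t)),
    Nat.card_eq_fintype_card, Nat.card_eq_fintype_card, Fintype.card_subtype, Fintype.card_subtype]
  have h : (Finset.univ.filter fun j ↦ j ≠ i₀ ∧ τ j = t) =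
      (Finset.univ.filter fun j ↦ τ j = t).erase i₀ := by
    ext
    simp
  rw [h]
  split_ifs with h0
  · rw [Finset.card_erase_add_one (by simpa using h0)]
  · rw [Finset.erase_eq_of_notMem (by simpa using h0), add_zero]

/-- Splitting off one factor of a product of groups. -/
def MulEquiv.piSplitAt {ι : Type*} [DecidableEq ι] (i : ι) (A : ι → Type*) [∀ i, Group (A i)] :
    (∀ i, A i) ≃* (∀ j : {j // j ≠ i}, A j) × A i :=
  { (Equiv.piSplitAt i A).trans (Equiv.prodComm _ _) with map_mul' := fun _ _ ↦ rfl }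

theorem mobiusNumber_pi_comp {T : Type*} [Fintype T] (S : T → Type*) [∀ t, Group (S t)]
    [∀ t, Finite (S t)] [∀ t, IsSimpleGroup (S t)]
    (hS : ∀ s t, s ≠ t → IsEmpty (S s ≃* S t)) {ι : Type*} [Finite ι] (τ : ι → T) :
    mobiusNumber (∀ i, S (τ i)) =
      ∏ t, ∏ j ∈ Finset.range (Nat.card {i // τ i = t}), simpleFactor (S t) j := by
  classical
  induction h : Nat.card ι generalizing ι with
  | zero =>
    have : IsEmpty ι := Finite.card_eq_zero_iff.mp h
    rw [mobiusNumber_of_subsingleton]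
    simp
  | succ n ih =>
    have : Nonempty ι := Finite.card_pos_iff.mp (by omega)
    -- Removing a factor of least order provides the order hypothesis of `mobiusNumber_pi_prod`. Its
    -- contribution is the last term, indexed by the number of remaining copies, in the product for
    -- its type.
    obtain ⟨i₀, hi₀⟩ := Finite.exists_min fun i ↦ Nat.card (S (τ i))
    have hn : Nat.card {j // j ≠ i₀} = n := by
      have := Nat.card_fiber_eq_card_fiber_ne_add (fun _ : ι ↦ ()) i₀ ()
      simp only [if_true] at this
      rw [Nat.card_congr (Equiv.subtypeUnivEquiv fun _ ↦ trivial),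
        Nat.card_congr (Equiv.subtypeUnivEquiv fun _ ↦ trivial)] at this
      omega
    rw [mobiusNumber_congr (MulEquiv.piSplitAt i₀ fun i ↦ S (τ i)),
      mobiusNumber_pi_prod (A := fun j : {j // j ≠ i₀} ↦ S (τ j)) fun j ↦ hi₀ j,
      ih (fun j : {j // j ≠ i₀} ↦ τ j) hn]
    have hk : Nat.card {j : {j // j ≠ i₀} // Nonempty (S (τ j) ≃* S (τ i₀))} =
        Nat.card {j : {j // j ≠ i₀} // τ j = τ i₀} := by
      refine Nat.card_congr (Equiv.subtypeEquivRight fun j ↦ ⟨fun hj ↦ ?_, fun hj ↦ ?_⟩)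
      · by_contra hne
        exact (hS _ _ hne).false hj.some
      · rw [hj]
        exact ⟨MulEquiv.refl _⟩
    rw [hk, ← Finset.mul_prod_erase _ _ (Finset.mem_univ (τ i₀)),
      ← Finset.mul_prod_erase Finset.univ (fun t ↦
        ∏ j ∈ Finset.range (Nat.card {i // τ i = t}), simpleFactor (S t) j)
        (Finset.mem_univ (τ i₀)), mul_right_comm, ← Finset.prod_range_succ]
    congr 1
    · rw [Nat.card_fiber_eq_card_fiber_ne_add τ i₀, if_pos rfl]
    · refine Finset.prod_congr rfl fun t ht ↦ ?_
      rw [Nat.card_fiber_eq_card_fiber_ne_add τ i₀, if_neg (Finset.ne_of_mem_erase ht).symm,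
        add_zero]

variable {n m : ℕ} (p f : Fin n → ℕ) (U : Fin m → Type u) (e : Fin m → ℕ)

/-- The cyclic groups of order `p i` and the groups `U i` as one family. -/
def SimpleFactors : Fin n ⊕ Fin m → Type u :=
  Sum.elim (fun i ↦ ULift (Multiplicative (ZMod (p i)))) U

instance [∀ i, Group (U i)] : ∀ t, Group (SimpleFactors p U t)
  | .inl i => inferInstanceAs (Group (ULift (Multiplicative (ZMod (p i)))))
  | .inr i => inferInstanceAs (Group (U i))

/-- `SimpleProduct` as a product over a single index type. -/
def simpleProductMulEquiv [∀ i, Group (U i)] :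
    SimpleProduct p f U e ≃* ∀ x : Σ t, Fin (Sum.elim f e t), SimpleFactors p U x.1 where
  toFun g
    | ⟨.inl i, j⟩ => ULift.up (g.1 i j)
    | ⟨.inr i, j⟩ => g.2 i j
  invFun h := (fun i j ↦ ULift.down (h ⟨.inl i, j⟩), fun i j ↦ h ⟨.inr i, j⟩)
  left_inv _ := rfl
  right_inv h := by
    funext ⟨t, j⟩
    cases t <;> rfl
  map_mul' g h := by
    funext ⟨t, j⟩
    cases t <;> rfl

theorem isSimpleGroup_multiplicative_zmod {q : ℕ} (hq : q.Prime) :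
    IsSimpleGroup (Multiplicative (ZMod q)) := by
  rw [CommGroup.is_simple_iff_prime_card]
  rwa [Nat.card_congr Multiplicative.toAdd, Nat.card_zmod]

theorem prod_range_neg_pow (q : ℤ) (k : ℕ) :
    ∏ j ∈ Finset.range k, -(q ^ j) = (-1) ^ k * q ^ k.choose 2 := by
  induction k with
  | zero => simp
  | succ k ih =>
    rw [Finset.prod_range_succ, ih, Nat.choose_succ_succ' k 1, Nat.choose_one_right]
    ring

theorem mobiusNumber_of_mulEquiv_simpleProduct [∀ i, Group (U i)] [∀ i, Finite (U i)]
    (h : AdmissibleFactors p U) {G : Type v} [Group G] [Finite G]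
    (φ : G ≃* SimpleProduct p f U e) :
    mobiusNumber G =
      (-1) ^ (∑ i, f i) * (∏ i, (p i : ℤ) ^ (f i).choose 2) *
        ∏ i, ∏ j ∈ Finset.Icc 1 (e i),
          (mobiusNumber (U i) - ((j : ℤ) - 1) * (Nat.card (MulAut (U i)) : ℤ)) := by
  have hne : ∀ i, NeZero (p i) := fun i ↦ ⟨(h.prime i).ne_zero⟩
  have hfin : ∀ t, Finite (SimpleFactors p U t) := by
    rintro (i | i)
    · exact inferInstanceAs (Finite (ULift (Multiplicative (ZMod (p i)))))
    · exact inferInstanceAs (Finite (U i))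
  have hsimple : ∀ t, IsSimpleGroup (SimpleFactors p U t) := by
    rintro (i | i)
    · have := isSimpleGroup_multiplicative_zmod (h.prime i)
      exact MulEquiv.isSimpleGroup
        (MulEquiv.ulift : ULift (Multiplicative (ZMod (p i))) ≃* Multiplicative (ZMod (p i)))
    · exact h.simple i
  have hcard : ∀ i, Nat.card (SimpleFactors p U (.inl i)) = p i := fun i ↦ by
    simp [SimpleFactors]
  have hcomm : ∀ i, ∀ a b : SimpleFactors p U (.inl i), a * b = b * a := fun i ↦
    mul_comm (G := ULift (Multiplicative (ZMod (p i))))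
  have hnoniso : ∀ s t, s ≠ t → IsEmpty (SimpleFactors p U s ≃* SimpleFactors p U t) := by
    have aux : ∀ i k, (SimpleFactors p U (.inl i) ≃* SimpleFactors p U (.inr k)) → False := by
      intro i k ψ
      obtain ⟨a, b, hab⟩ := h.nonabelian k
      apply hab
      apply ψ.symm.injective
      exact (map_mul ψ.symm a b).trans ((hcomm i _ _).trans (map_mul ψ.symm b a).symm)
    rintro (i | i) (k | k) hik <;> refine ⟨fun ψ ↦ ?_⟩
    · have := Nat.card_congr ψ.toEquiv
      rw [hcard, hcard] at this
      exact hik (congrArg _ (h.distinct this))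
    · exact aux i k ψ
    · exact aux k i ψ.symm
    · exact (h.nonisomorphic i k fun h ↦ hik (congrArg _ h)).false ψ
  rw [mobiusNumber_congr (φ.trans (simpleProductMulEquiv p f U e)),
    mobiusNumber_pi_comp (SimpleFactors p U) hnoniso
      (Sigma.fst : (Σ t, Fin (Sum.elim f e t)) → Fin n ⊕ Fin m), Fintype.prod_sum_type]
  have hfib : ∀ t, Nat.card {x : Σ t, Fin (Sum.elim f e t) // x.1 = t} = Sum.elim f e t := fun t ↦
    (Nat.card_congr (Equiv.sigmaSubtype t)).trans (by simp)
  congr 1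
  · rw [← Finset.prod_pow_eq_pow_sum, ← Finset.prod_mul_distrib]
    refine Finset.prod_congr rfl fun i _ ↦ ?_
    rw [hfib, Sum.elim_inl, ← prod_range_neg_pow]
    refine Finset.prod_congr rfl fun j _ ↦ ?_
    rw [simpleFactor, if_pos (hcomm i), hcard]
  · refine Finset.prod_congr rfl fun i _ ↦ ?_
    -- Shift the index: `j - 1` with `j` from `1` to `e i` counts the copies already present,
    -- starting from `0`.
    rw [hfib, Sum.elim_inr, ← Finset.Ico_add_one_right_eq_Icc, Finset.prod_Ico_eq_prod_range,
      Nat.add_sub_cancel]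
    refine Finset.prod_congr rfl fun j _ ↦ ?_
    have hn : ¬ ∀ a b : SimpleFactors p U (.inr i), a * b = b * a := by
      obtain ⟨a, b, hab⟩ := h.nonabelian i
      exact fun H ↦ hab (H a b)
    rw [simpleFactor, if_neg hn]
    push_cast
    rw [add_sub_cancel_left]
    rfl

end SimpleProductMoebius

/-! ### The socle as a direct product of simple groups -/

section Socle

variable {G : Type*} [Group G]

theorem IsMinimalNormal.map_mulEquiv {N : Subgroup G} (hN : IsMinimalNormal N) (φ : G ≃* G) :
    IsMinimalNormal (N.map φ.toMonoidHom) := by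
  have := hN.prop.1
  refine ⟨⟨this.map _ φ.surjective, fun h ↦ hN.prop.2 ?_⟩, fun K hK hle ↦ ?_⟩
  · exact (Subgroup.map_eq_bot_iff_of_injective N (f := φ.toMonoidHom) φ.injective).mp h
  · obtain ⟨hKn, hKb⟩ := hK
    have h1 : K.comap φ.toMonoidHom ≤ N := by
      intro x hx
      obtain ⟨y, hy, hyx⟩ := hle hx
      rwa [← φ.injective hyx]
    have h2 : K.comap φ.toMonoidHom ≠ ⊥ := by
      intro h
      apply hKb
      rw [← Subgroup.map_comap_eq_self_of_surjective (f := φ.toMonoidHom) φ.surjective K, h,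
        Subgroup.map_bot]
    exact Subgroup.map_le_iff_le_comap.mpr (hN.le_of_le ⟨hKn.comap _, h2⟩ h1)

instance socle_characteristic : (socle G).Characteristic := by
  rw [Subgroup.characteristic_iff_map_le]
  intro φ
  rw [Subgroup.map_le_iff_le_comap]
  refine sSup_le fun N hN ↦ ?_
  rw [← Subgroup.map_le_iff_le_comap]
  exact le_sSup (hN.map_mulEquiv φ)

/-- The second socle is characteristic in the first, hence normal in `G`. Each minimal normal `N` of
`G` contains a minimal normal subgroup of the socle, so it meets the second socle nontrivially and
by minimality lies in it. -/
theorem socle_socle_eq_top [Finite G] : socle (socle G) = ⊤ := by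
  have hn : ((socle (socle G)).map (socle G).subtype).Normal := inferInstance
  suffices h : socle G ≤ (socle (socle G)).map (socle G).subtype by
    rw [eq_top_iff]
    intro x _
    obtain ⟨y, hy, hyx⟩ := h x.2
    rwa [← Subtype.ext hyx]
  refine sSup_le fun N (hN : IsMinimalNormal N) ↦ ?_
  have hle : N ≤ socle G := le_sSup hN
  have := hN.prop.1
  have hN' : (N.subgroupOf (socle G)).Normal ∧ N.subgroupOf (socle G) ≠ ⊥ := by
    refine ⟨inferInstance, fun h ↦ hN.prop.2 ?_⟩
    rwa [Subgroup.subgroupOf_eq_bot, disjoint_of_le_iff_left_eq_bot hle] at h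
  obtain ⟨T, hTle, hT⟩ := exists_minimal_le_of_wellFoundedLT
    (fun H : Subgroup (socle G) ↦ H.Normal ∧ H ≠ ⊥) _ hN'
  have hT1 : T.map (socle G).subtype ≤ N := by
    rintro _ ⟨y, hy, rfl⟩
    exact hTle hy
  have hT2 : T.map (socle G).subtype ≤ (socle (socle G)).map (socle G).subtype :=
    Subgroup.map_mono (le_sSup hT)
  have hT3 : T.map (socle G).subtype ≠ ⊥ := fun h ↦ hT.prop.2
    ((Subgroup.map_eq_bot_iff_of_injective T (socle G).subtype_injective).mp h)
  have := hN.le_of_le (y := N ⊓ (socle (socle G)).map (socle G).subtype)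
    ⟨inferInstance, fun h ↦ hT3 (le_bot_iff.mp (h ▸ le_inf hT1 hT2))⟩ inf_le_left
  exact this.trans inf_le_right

/-- Take an inclusion-minimal generating set of minimal normal subgroups: a member meeting the join
of the others nontrivially would lie in that join and be superfluous. -/
theorem exists_sSupIndep_isMinimalNormal [Finite G] (h : socle G = ⊤) :
    ∃ s : Set (Subgroup G), (∀ N ∈ s, IsMinimalNormal N) ∧ sSup s = ⊤ ∧ sSupIndep s := by
  obtain ⟨s, hs⟩ := exists_minimal_of_wellFoundedLT
    (fun s : Set (Subgroup G) ↦ (∀ N ∈ s, IsMinimalNormal N) ∧ sSup s = ⊤) ⟨_, fun _ h ↦ h, h⟩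
  refine ⟨s, hs.prop.1, hs.prop.2, fun N hN ↦ ?_⟩
  have hmin := hs.prop.1 N hN
  have := hmin.prop.1
  have : (sSup (s \ {N})).Normal := by
    exact Subgroup.sSup_normal _ fun K hK ↦ (hs.prop.1 K hK.1).prop.1
  rw [disjoint_iff]
  by_contra hne
  have hle : N ≤ sSup (s \ {N}) :=
    (hmin.le_of_le (y := N ⊓ sSup (s \ {N})) ⟨inferInstance, hne⟩ inf_le_left).trans inf_le_right
  have htop : sSup (s \ {N}) = ⊤ := by
    rw [eq_top_iff, ← hs.prop.2]
    refine sSup_le fun K hK ↦ ?_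
    rcases eq_or_ne K N with rfl | hKN
    · exact hle
    · exact le_sSup ⟨hK, hKN⟩
  exact (hs.le_of_le ⟨fun K hK ↦ hs.prop.1 K hK.1, htop⟩ Set.sdiff_subset hN).2 rfl

/-- A normal subgroup of one direct factor `N` is normalized by `N` and centralized by the other
factors, so it is normal in `G`; minimality of `N` then makes `N` simple. -/
theorem exists_mulEquiv_pi_isSimpleGroup_of_socle_eq_top [Finite G] (h : socle G = ⊤) :
    ∃ s : Set (Subgroup G), (∀ N : s, IsSimpleGroup N.1) ∧ Nonempty (G ≃* ∀ N : s, N.1) := by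
  classical
  obtain ⟨s, hs, htop, hind⟩ := exists_sSupIndep_isMinimalNormal h
  have hcomm : ∀ N ∈ s, ∀ K ∈ s, N ≠ K → ∀ x y, x ∈ N → y ∈ K → Commute x y :=
    fun N hN K hK hNK ↦ Subgroup.commute_of_normal_of_disjoint N K (hs N hN).prop.1
      (hs K hK).prop.1 (hind.pairwiseDisjoint hN hK hNK)
  refine ⟨s, fun ⟨N, hN⟩ ↦ ?_, ?_⟩
  · have : Nontrivial N := (Subgroup.nontrivial_iff_ne_bot N).mpr (hs N hN).prop.2
    refine ⟨fun M hM ↦ ?_⟩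
    have hnorm : (M.map N.subtype).Normal := by
      rw [← Subgroup.normalizer_eq_top_iff, eq_top_iff, ← htop]
      refine sSup_le fun K hK ↦ ?_
      have key : ∀ k ∈ K, ∀ x ∈ M.map N.subtype, k * x * k⁻¹ ∈ M.map N.subtype := by
        rintro k hk _ ⟨x, hx, rfl⟩
        rcases eq_or_ne N K with rfl | hNK
        · exact ⟨⟨k, hk⟩ * x * ⟨k, hk⟩⁻¹, hM.conj_mem x hx ⟨k, hk⟩, rfl⟩
        · have := hcomm N hN K hK hNK x k x.2 hk
          refine ⟨x, hx, ?_⟩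
          rw [Subgroup.subtype_apply, ← this.eq, mul_inv_cancel_right]
      intro k hk
      rw [Subgroup.mem_normalizer_iff]
      refine fun x ↦ ⟨key k hk x, fun hx ↦ ?_⟩
      have := key k⁻¹ (K.inv_mem hk) _ hx
      simpa [mul_assoc] using this
    by_cases hb : M.map N.subtype = ⊥
    · exact Or.inl ((Subgroup.map_eq_bot_iff_of_injective M N.subtype_injective).mp hb)
    · right
      have hle := (hs N hN).le_of_le ⟨hnorm, hb⟩ (Subgroup.map_subtype_le M)
      rw [eq_top_iff]
      intro x _
      obtain ⟨y, hy, hyx⟩ := hle x.2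
      rwa [← Subtype.ext hyx]
  · have := Fintype.ofFinite s
    have hc : Pairwise fun N K : s ↦ ∀ x y : G, x ∈ N.1 → y ∈ K.1 → Commute x y :=
      fun N K hNK ↦ hcomm N N.2 K K.2 (Subtype.coe_ne_coe.mpr hNK)
    refine ⟨(MulEquiv.ofBijective (Subgroup.noncommPiCoprod (H := fun N : s ↦ N.1) hc)
      ⟨Subgroup.injective_noncommPiCoprod_of_iSupIndep ((sSupIndep_iff s).mp hind), ?_⟩).symm⟩
    rw [← MonoidHom.range_eq_top, Subgroup.noncommPiCoprod_range, ← sSup_eq_iSup', htop]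

end Socle

/-! ### Collecting isomorphic factors -/

section Grouping

theorem nonempty_mulEquiv_pi_fibers {I T : Type*} [Finite I] (τ : I → T) {A : I → Type*}
    {S : T → Type*} [∀ i, Group (A i)] [∀ t, Group (S t)] {k : T → ℕ}
    (hk : ∀ t, k t = Nat.card {i // τ i = t}) (h : ∀ i, Nonempty (A i ≃* S (τ i))) :
    Nonempty ((∀ i, A i) ≃* ∀ x : Σ t, Fin (k t), S x.1) := by
  let ρ : (Σ t, Fin (k t)) ≃ I :=
    (Equiv.sigmaCongrRight fun t ↦ (Finite.equivFinOfCardEq (hk t).symm).symm).trans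
      (Equiv.sigmaFiberEquiv τ)
  have hρ : ∀ x, τ (ρ x) = x.1 := fun x ↦
    ((Finite.equivFinOfCardEq (hk x.1).symm).symm x.2).2
  have hA : ∀ x, Nonempty (A (ρ x) ≃* S x.1) := fun x ↦ by
    have := h (ρ x)
    rwa [hρ] at this
  let φ : (∀ i, A i) ≃* ∀ x, A (ρ x) :=
    { (Equiv.piCongrLeft A ρ).symm with map_mul' := fun _ _ ↦ rfl }
  exact ⟨φ.trans (MulEquiv.piCongrRight fun x ↦ (hA x).some)⟩

theorem exists_equiv_fin_sum_fin {Q : Type*} [Finite Q] (P : Q → Prop) :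
    ∃ (n m : ℕ) (ε : Q ≃ Fin n ⊕ Fin m),
      (∀ k, P (ε.symm (.inl k))) ∧ ∀ k, ¬ P (ε.symm (.inr k)) := by
  classical
  obtain ⟨n, ⟨a⟩⟩ := Finite.exists_equiv_fin {q // P q}
  obtain ⟨m, ⟨b⟩⟩ := Finite.exists_equiv_fin {q // ¬ P q}
  refine ⟨n, m, (Equiv.sumCompl P).symm.trans (Equiv.sumCongr a b), fun k ↦ ?_, fun k ↦ ?_⟩
  · simpa using (a.symm k).2
  · simpa using (b.symm k).2

theorem IsSimpleGroup.isCyclic_of_comm {N : Type*} [Group N] [IsSimpleGroup N] [Finite N]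
    (hN : ∀ a b : N, a * b = b * a) : IsCyclic N :=
  have := Fact.mk (IsSimpleGroup.prime_card_of_comm hN)
  isCyclic_of_prime_card rfl

/-- One representative per isomorphism class, with the class size as exponent. Abelian classes have
prime order, and the primes are distinct because cyclic groups of equal order are isomorphic. -/
theorem exists_mulEquiv_simpleProduct {I : Type*} [Finite I] (A : I → Type w)
    [∀ i, Group (A i)] [∀ i, Finite (A i)] [∀ i, IsSimpleGroup (A i)] :
    ∃ (n m : ℕ) (p f : Fin n → ℕ) (U : Fin m → Type w) (_ : ∀ i, Group (U i))
        (_ : ∀ i, Finite (U i)) (e : Fin m → ℕ),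
      AdmissibleFactors p U ∧ Nonempty ((∀ i, A i) ≃* SimpleProduct p f U e) := by
  let r : Setoid I :=
    { r := fun i j ↦ Nonempty (A i ≃* A j)
      iseqv := ⟨fun _ ↦ ⟨MulEquiv.refl _⟩, fun ⟨a⟩ ↦ ⟨a.symm⟩, fun ⟨a⟩ ⟨b⟩ ↦ ⟨a.trans b⟩⟩ }
  let B : Quotient r → Type w := fun q ↦ A q.out
  have hB : ∀ q q' (_ : B q ≃* B q'), q = q' := fun q q' ψ ↦
    Quotient.out_equiv_out.mp (show Nonempty (A q.out ≃* A q'.out) from ⟨ψ⟩)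
  have hAB : ∀ i, Nonempty (A i ≃* B ⟦i⟧) := fun i ↦ r.symm (Quotient.mk_out i)
  obtain ⟨n, m, ε, hab, hnab⟩ :=
    exists_equiv_fin_sum_fin fun q : Quotient r ↦ ∀ a b : B q, a * b = b * a
  let τ : I → Fin n ⊕ Fin m := fun i ↦ ε ⟦i⟧
  let p : Fin n → ℕ := fun i ↦ Nat.card (B (ε.symm (.inl i)))
  let U : Fin m → Type w := fun i ↦ B (ε.symm (.inr i))
  have hcyc : ∀ i, IsCyclic (B (ε.symm (.inl i))) := fun i ↦
    IsSimpleGroup.isCyclic_of_comm (hab i)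
  let _ : ∀ i, Group (U i) := fun i ↦ inferInstanceAs (Group (A _))
  have hU : ∀ i, Finite (U i) := fun i ↦ inferInstanceAs (Finite (A _))
  refine ⟨n, m, p, fun i ↦ Nat.card {j // τ j = .inl i}, U, inferInstance, hU,
    fun i ↦ Nat.card {j // τ j = .inr i}, ⟨?_, ?_, ?_, ?_, ?_⟩, ?_⟩
  · exact fun i ↦ IsSimpleGroup.prime_card_of_comm (hab i)
  · intro i j hij
    have := hB _ _ (mulEquivOfCyclicCardEq hij)
    exact Sum.inl_injective (ε.symm.injective this)
  · exact fun i ↦ inferInstanceAs (IsSimpleGroup (A _))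
  · intro i
    have := hnab i
    push Not at this
    exact this
  · exact fun i j hij ↦ ⟨fun ψ ↦ hij (Sum.inr_injective (ε.symm.injective (hB _ _ ψ)))⟩
  · obtain ⟨φ⟩ := nonempty_mulEquiv_pi_fibers τ (A := A) (S := SimpleFactors p U)
      (k := Sum.elim (fun i ↦ Nat.card {j // τ j = .inl i}) fun i ↦ Nat.card {j // τ j = .inr i})
      (by rintro (i | i) <;> rfl) (fun i ↦ by
        obtain ⟨ψ⟩ := hAB i
        have hτ : ⟦i⟧ = ε.symm (τ i) := by simp [τ]
        rw [hτ] at ψ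
        rcases h : τ i with j | j
        · rw [h] at ψ
          exact ⟨ψ.trans ((zmodCyclicMulEquiv (hcyc j)).symm.trans MulEquiv.ulift.symm)⟩
        · rw [h] at ψ
          exact ⟨ψ⟩)
    exact ⟨φ.trans (simpleProductMulEquiv p _ U _).symm⟩

end Grouping

theorem theorem1 :
    (∀ (n m : ℕ) (p f : Fin n → ℕ) (U : Fin m → Type u) [∀ i, Group (U i)] [∀ i, Finite (U i)]
        (e : Fin m → ℕ), AdmissibleFactors p U →
      ∀ (G : Type v) [Group G] [Finite G], Nonempty (G ≃* SimpleProduct p f U e) →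
        mobiusNumber G =
          (-1) ^ (∑ i, f i) * (∏ i, (p i : ℤ) ^ (f i).choose 2) *
            ∏ i, ∏ j ∈ Finset.Icc 1 (e i),
              (mobiusNumber (U i) - ((j : ℤ) - 1) * (Nat.card (MulAut (U i)) : ℤ))) ∧
    (∀ (Γ : Type w) [Group Γ] [Finite Γ],
      ∃ (n m : ℕ) (p f : Fin n → ℕ) (U : Fin m → Type w) (_ : ∀ i, Group (U i))
          (_ : ∀ i, Finite (U i)) (e : Fin m → ℕ),
        AdmissibleFactors p U ∧ Nonempty (socle Γ ≃* SimpleProduct p f U e)) := by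
  refine ⟨fun n m p f U _ _ e h G _ _ ⟨φ⟩ ↦ mobiusNumber_of_mulEquiv_simpleProduct p f U e h φ,
    fun Γ _ _ ↦ ?_⟩
  obtain ⟨s, hs, ⟨φ⟩⟩ := exists_mulEquiv_pi_isSimpleGroup_of_socle_eq_top
    (socle_socle_eq_top (G := Γ))
  obtain ⟨n, m, p, f, U, hG, hF, e, h, ⟨ψ⟩⟩ := exists_mulEquiv_simpleProduct fun N : s ↦ N.1
  exact ⟨n, m, p, f, U, hG, hF, e, h, ⟨φ.trans ψ⟩⟩
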